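/- **Setting.** Let $k\ge 1$ and let $\Lambda$ be a finite, strongly connected $k$-graph with vertex set $\Lambda^0$ and vertex matrices $A_i(v,w)=|v\Lambda^{e_i}w|$ $(1\le i\le k)$. Let $\rho_i$ be the spectral radius of $A_i$ and suppose that $\rho_i>1$ for all $i$. Let $\kappa\in(0,\infty)^{\Lambda^0}$ be the unimodular Perron–Frobenius eigenvector: $\sum_v\kappa_v=1$ and $A_i\kappa=\rho_i\kappa$ for all $i$. Let $\mathcal B_\Lambda$ be the associated stationary $k$-Bratteli diagram: all levels $V_0,V_1,\dots$ are copies of $\Lambda^0$, and for $n=qk+t$, $0\le t\le k-1$, there are $A_{t+1}(p,q')$ edges with range $p\in V_n$ and source $q'\in V_{n+1}$. Let $\partial\mathcal B_\Lambda$ be the space of infinite paths that start in $V_0$, with the topology generated by the cylinder sets $[\eta]$. Let $F$ be the set of finite paths that start in $V_0$ (those of length $0$ are the vertices of $V_0$) together with the empty path $\emptyset$, which is the root of the tree of finite paths: $[\emptyset]=\partial\mathcal B_\Lambda$, and the one-step extensions of $\emptyset$ are the vertices of $V_0$. Let $\mu$ be the Borel probability measure on $\partial\mathcal B_\Lambda$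 with $$\mu[\eta]=(\rho_1^{q+1}\cdots\rho_t^{q+1}\rho_{t+1}^{q}\cdots\rho_k^{q})^{-1}\kappa_{s(\eta)}\qquad(|\eta|=qk+t,\ 0\le t\le k-1).$$ Fix $\delta\in(0,1)$ and put $w_\delta(\emptyset)=1$ and $w_\delta(\eta)=(\rho_1^{q+1}\cdots\rho_t^{q+1}\rho_{t+1}^{q}\cdots\rho_k^{q})^{-1/\delta}\kappa_{s(\eta)}$ for $|\eta|=qk+t$. For $x\neq y$ let $x\wedge y\in F$ be the longest common initial path ($\emptyset$ if $x$ and $y$ start at different vertices), and put $d_{w_\delta}(x,y)=w_\delta(x\wedge y)$, $d_{w_\delta}(x,x)=0$. Assume that $\operatorname{diam}_{d_{w_\delta}}[\eta]=w_\delta(\eta)$ for every finite path $\eta$ that starts in $V_0$. For $s\in\mathbb R$ and $\gamma\in F$ let $$G_s(\gamma)=\tfrac12\, w_\delta(\gamma)^{2-s}\sum_{e\ne e'}\mu[\gamma e]\,\mu[\gamma e'],$$ the sum being over ordered pairs of distinct one-step extensions $\gamma e,\gamma e'$ of $\gamma$, and $$\lambda_{s,\gamma}=\sum_{j=0}^{m-1}\frac{\mu[\gamma_{j+1}]-\mu[\gamma_j]}{G_s(\gamma_j)}-\frac{\mu[\gamma]}{G_s(\gamma)},$$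 where $\emptyset=\gamma_0,\gamma_1,\dots,\gamma_m=\gamma$ are the successive initial paths of $\gamma$, from the root to $\gamma$ (if $|\Lambda^0|=1$, the term $j=0$, which has the form $0/0$, is omitted). Put $d^{(s)}(x,x)=0$ and $d^{(s)}(x,y)=-1/\lambda_{s,x\wedge y}$ for $x\ne y$, and $B_s(x,r)=\{y: d^{(s)}(x,y)<r\}$. For $\gamma\in F$ with $m_\gamma+1$ one-step extensions, let $\psi_{\gamma,1},\dots,\psi_{\gamma,m_\gamma}$ be an $L^2(\mu)$-orthonormal basis of $$E_{s,\gamma}=\operatorname{span}\Big\{\frac{\chi_{[\gamma e]}}{\mu[\gamma e]}-\frac{\chi_{[\gamma e']}}{\mu[\gamma e']}: e\ne e'\Big\}$$ (for $|\Lambda^0|=1$, $E_{s,\emptyset}=0$), and let the heat kernel be $$p(t,x,y)=1+\sum_{\gamma\in F}e^{\lambda_{s,\gamma}t}\sum_{j=1}^{m_\gamma}\psi_{\gamma,j}(x)\,\psi_{\gamma,j}(y).$$ **Proposition.** Suppose that $s<2$. Then the series defining $p(t,x,y)$ converges absolutely for all $t>0$ and $x,y\in\partial\mathcal B_\Lambda$,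 and: (a) For all $x\in\partial\mathcal B_\Lambda$ and $t>0$, $\displaystyle p(t,x,x)\ge\frac1e\cdot\frac1{\mu(B_s(x,t))}$. (b) For all $x,y\in\partial\mathcal B_\Lambda$ and $0<t\le d^{(s)}(x,y)$, $\displaystyle p(t,x,y)\le\frac{1}{d^{(s)}(x,y)\,\mu[x\wedge y]}$. -/

import Mathlib

open MeasureTheory

universe u v

/-- A `k`-graph (higher-rank graph): a category with a degree functor to `ℕ^k` that has the unique
factorization property.  A path with source `v` and range `w` is a morphism `v ⟶ w`, so that the
composite path `μν` of the `k`-graph literature is `ν ≫ μ`. -/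
structure KGraph (k : ℕ) (V : Type u) [CategoryTheory.Category.{v} V] where
  degree : ∀ {v w : V}, (v ⟶ w) → (Fin k → ℕ)
  degree_id : ∀ v : V, degree (CategoryTheory.CategoryStruct.id v) = 0
  degree_comp : ∀ {u v w : V} (f : u ⟶ v) (g : v ⟶ w),
    degree (CategoryTheory.CategoryStruct.comp f g) = degree g + degree f
  factorization : ∀ {v w : V} (l : v ⟶ w) (m n : Fin k → ℕ), degree l = m + n →
    ∃! p : (Σ u : V, (u ⟶ w) × (v ⟶ u)),
      degree p.2.1 = m ∧ degree p.2.2 = n ∧ CategoryTheory.CategoryStruct.comp p.2.2 p.2.1 = l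

namespace KGraph

variable {k : ℕ} {V : Type u} [CategoryTheory.Category.{v} V]

/-- There are finitely many paths of each degree. -/
def IsFinite (L : KGraph k V) : Prop :=
  ∀ n : Fin k → ℕ, Finite {p : (Σ v : V, Σ w : V, (v ⟶ w)) // L.degree p.2.2 = n}

/-- Any two vertices are joined by a path. -/
def StronglyConnected (_L : KGraph k V) : Prop :=
  ∀ v w : V, Nonempty (w ⟶ v)

/-- The `i`-th vertex matrix: `A_i(v, w)` is the number of paths of degree `e_i` with range `v` and
source `w`. -/
noncomputable def vertexMatrix (L : KGraph k V) (i : Fin k) : Matrix V V ℕ :=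
  fun v w => Nat.card {l : w ⟶ v // L.degree l = Pi.single i 1}

/-- The spectral radius `ρ_i` of the `i`-th vertex matrix. -/
noncomputable def rho [Fintype V] [DecidableEq V] (L : KGraph k V) (i : Fin k) : ℝ :=
  (spectralRadius ℂ ((L.vertexMatrix i).map (fun a : ℕ => (a : ℂ)))).toReal

/-- `κ` is the unimodular Perron-Frobenius eigenvector: it is positive, its entries add up to `1`,
and `A_i κ = ρ_i κ` for all `i`. -/
def IsPerronFrobenius [Fintype V] [DecidableEq V] (L : KGraph k V) (κ : V → ℝ) : Prop :=
  (∀ v, 0 < κ v) ∧ ∑ v, κ v = 1 ∧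
    ∀ i, ((L.vertexMatrix i).map (fun a : ℕ => (a : ℝ))).mulVec κ = L.rho i • κ

end KGraph

/-! ### The stationary `k`-Bratteli diagram of a family of matrices

Every level is a copy of `V`.  The edges between level `n` and level `n + 1` (with range in level
`n`, source in level `n + 1`) are of colour `n mod k`: there are `A_{n mod k}(p, q)` of them with
range `p` and source `q`.  Colours are numbered from `0`. -/

namespace Bratteli

/-- The colour of the edges between the levels `n` and `n + 1`. -/
def color (k : ℕ) [NeZero k] (n : ℕ) : Fin k := Fin.ofNat k n

variable {k : ℕ} [NeZero k] {V : Type u}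

/-- An infinite path that starts in level `0`: the vertices that it visits and, at each step, one of
the edges between two consecutive ones. -/
structure InfPath (A : Fin k → Matrix V V ℕ) where
  vert : ℕ → V
  edge : ∀ n, Fin (A (color k n) (vert n) (vert (n + 1)))

/-- The nodes of depth `m` of the rooted tree of finite paths.  For `m = n + 1` they are the finite
paths of length `n` that start in level `0` (they visit `n + 1` vertices); in particular those of
depth `1` are the vertices of level `0`.  For `m = 0` there is exactly one, the empty path `∅`, which
is the root. -/
@[ext]
structure Seg (A : Fin k → Matrix V V ℕ) (m : ℕ) where
  vert : Fin m → V
  edge : ∀ (i : ℕ) (h : i + 1 < m),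
    Fin (A (color k i) (vert ⟨i, (Nat.lt_succ_self i).trans h⟩) (vert ⟨i + 1, h⟩))

/-- All nodes: the finite paths that start in level `0`, together with the empty path. -/
abbrev Node (A : Fin k → Matrix V V ℕ) := Σ m : ℕ, Seg A m

variable {A : Fin k → Matrix V V ℕ}

instance Seg.instFinite [Finite V] (m : ℕ) : Finite (Seg A m) := by
  have : Finite {i : ℕ // i + 1 < m} :=
    Finite.of_injective (fun i => (⟨i.1, (Nat.lt_succ_self i.1).trans i.2⟩ : Fin m))
      (fun a b h => Subtype.ext (by simpa using h))
  let f : Seg A m → Σ f : Fin m → V, ∀ i : {i : ℕ // i + 1 < m},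
      Fin (A (color k i.1) (f ⟨i.1, (Nat.lt_succ_self i.1).trans i.2⟩) (f ⟨i.1 + 1, i.2⟩)) :=
    fun γ => ⟨γ.vert, fun i => γ.edge i.1 i.2⟩
  refine Finite.of_injective f ?_
  rintro ⟨v₁, e₁⟩ ⟨v₂, e₂⟩ h
  simp only [f, Sigma.mk.injEq] at h
  obtain ⟨rfl, h⟩ := h
  have h' := eq_of_heq h
  congr
  funext i hi
  exact congrFun h' ⟨i, hi⟩

noncomputable instance Seg.instFintype [Finite V] (m : ℕ) : Fintype (Seg A m) :=
  Fintype.ofFinite _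

/-- The initial piece of depth `j` of a node. -/
def Seg.take {m : ℕ} (γ : Seg A m) (j : ℕ) (h : j ≤ m) : Seg A j where
  vert := fun i => γ.vert (Fin.castLE h i)
  edge := fun i hi => γ.edge i (lt_of_lt_of_le hi h)

/-- The initial piece of depth `m` of an infinite path. -/
def InfPath.seg (x : InfPath A) (m : ℕ) : Seg A m where
  vert := fun i => x.vert i
  edge := fun i _ => x.edge i

/-- The cylinder set `[γ]`; for the root it is the set of all infinite paths. -/
def cyl {m : ℕ} (γ : Seg A m) : Set (InfPath A) := {x | x.seg m = γ}

/-- The topology generated by the cylinder sets. -/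
instance : TopologicalSpace (InfPath A) :=
  TopologicalSpace.generateFrom {S | ∃ (m : ℕ) (γ : Seg A m), S = cyl γ}

instance : MeasurableSpace (InfPath A) := borel _

instance : BorelSpace (InfPath A) := ⟨rfl⟩

open Classical in
/-- The one-step extensions `γe` of a node; those of the root are the vertices of level `0`. -/
noncomputable def children [Finite V] {m : ℕ} (γ : Seg A m) : Finset (Seg A (m + 1)) :=
  Finset.univ.filter (fun α => α.take m (Nat.le_succ m) = γ)

/-- The product of the first `n` terms of `ρ_1, …, ρ_k, ρ_1, …, ρ_k, …`; if `n = qk + t` with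
`0 ≤ t < k`, it is `ρ_1^(q+1) ⋯ ρ_t^(q+1) ρ_(t+1)^q ⋯ ρ_k^q`. -/
noncomputable def levelProd (ρ : Fin k → ℝ) (n : ℕ) : ℝ := ∏ j ∈ Finset.range n, ρ (color k j)

/-- `μ` is the Borel probability measure with `μ[η] = κ_{s(η)} / (ρ^q ρ_1 ⋯ ρ_t)` for every finite
path `η` of length `n = qk + t` that starts in level `0`, where `ρ = ρ_1 ⋯ ρ_k`. -/
def IsSelfSimilar (ρ : Fin k → ℝ) (κ : V → ℝ) (μ : Measure (InfPath A)) : Prop :=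
  IsProbabilityMeasure μ ∧
    ∀ (n : ℕ) (η : Seg A (n + 1)), μ.real (cyl η) = (levelProd ρ n)⁻¹ * κ (η.vert (Fin.last n))

/-- The weight `w_δ`, with `w_δ(∅) = 1`. -/
noncomputable def weight (ρ : Fin k → ℝ) (κ : V → ℝ) (δ : ℝ) : {m : ℕ} → Seg A m → ℝ
  | 0, _ => 1
  | n + 1, γ => (levelProd ρ n) ^ (-1 / δ) * κ (γ.vert (Fin.last n))

/-- The depth of the longest common initial path of two distinct infinite paths. -/
noncomputable def wedgeDepth (x y : InfPath A) : ℕ := sSup {m | x.seg m = y.seg m}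

/-- The longest common initial path `x ∧ y` of two distinct infinite paths (it is the root if they
start at different vertices). -/
noncomputable def wedge (x y : InfPath A) : Seg A (wedgeDepth x y) := x.seg (wedgeDepth x y)

open Classical in
/-- The ultrametric `d_{w_δ}`. -/
noncomputable def weightDist (ρ : Fin k → ℝ) (κ : V → ℝ) (δ : ℝ) (x y : InfPath A) : ℝ :=
  if x = y then 0 else weight ρ κ δ (wedge x y)

/-- `diam [γ] = w_δ(γ)` for every finite path `γ` that starts in level `0`, where the diameter is
taken with respect to `d_{w_δ}`. -/
def DiamEqWeight (A : Fin k → Matrix V V ℕ) (ρ : Fin k → ℝ) (κ : V → ℝ) (δ : ℝ) : Prop :=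
  ∀ (n : ℕ) (γ : Seg A (n + 1)),
    IsLUB {r : ℝ | ∃ x ∈ cyl γ, ∃ y ∈ cyl γ, r = weightDist ρ κ δ x y} (weight ρ κ δ γ)

section Heat

variable [Finite V] (ρ : Fin k → ℝ) (κ : V → ℝ) (δ s : ℝ) (μ : Measure (InfPath A))

open Classical in
/-- `G_s(γ) = (1/2) w_δ(γ)^(2-s) ∑ μ[γe] μ[γe']`, where the sum is over all ordered pairs of distinct
one-step extensions of `γ`. -/
noncomputable def G {m : ℕ} (γ : Seg A m) : ℝ :=
  1 / 2 * weight ρ κ δ γ ^ (2 - s) *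
    ∑ p ∈ (children γ ×ˢ children γ).filter (fun p => p.1 ≠ p.2),
      μ.real (cyl p.1) * μ.real (cyl p.2)

/-- The eigenvalue `λ_{s,γ}` of the Laplace-Beltrami operator.  If there is only one vertex, then the
root has only one extension, and its term in the sum is `0 / 0 = 0`. -/
noncomputable def eigenvalue {m : ℕ} (γ : Seg A m) : ℝ :=
  (∑ j : Fin m,
    (μ.real (cyl (γ.take (j + 1) j.isLt)) - μ.real (cyl (γ.take j j.isLt.le))) /
      G ρ κ δ s μ (γ.take j j.isLt.le))
    - μ.real (cyl γ) / G ρ κ δ s μ γ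

open Classical in
/-- The intrinsic metric `d^{(s)}`. -/
noncomputable def intrinsicDist (x y : InfPath A) : ℝ :=
  if x = y then 0 else -1 / eigenvalue ρ κ δ s μ (wedge x y)

/-- The open ball `B_s(x, r)` of the intrinsic metric. -/
noncomputable def intrinsicBall (x : InfPath A) (r : ℝ) : Set (InfPath A) :=
  {y | intrinsicDist ρ κ δ s μ x y < r}

/-- The eigenspace `E_{s,γ}`, spanned by the functions `χ_[γe] / μ[γe] - χ_[γe'] / μ[γe']`, where `γe`
and `γe'` are distinct one-step extensions of `γ`. -/
noncomputable def eigenspace {m : ℕ} (γ : Seg A m) : Submodule ℝ (InfPath A → ℝ) :=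
  Submodule.span ℝ {f | ∃ α ∈ children γ, ∃ β ∈ children γ, α ≠ β ∧
    f = (cyl α).indicator (fun _ => 1 / μ.real (cyl α)) -
      (cyl β).indicator (fun _ => 1 / μ.real (cyl β))}

/-- The dimension `m_γ` of the eigenspace: the number of one-step extensions of `γ`, minus one. -/
noncomputable def eigenDim (γ : Node A) : ℕ := (children γ.2).card - 1

/-- For each node `γ`, the functions `ψ_{γ,1}, …, ψ_{γ,m_γ}` are an `L²(μ)`-orthonormal basis of the
eigenspace of `γ`. -/
def IsEigenbasis (ψ : ∀ γ : Node A, Fin (eigenDim γ) → InfPath A → ℝ) : Prop :=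
  ∀ γ : Node A,
    (∀ i j, ∫ z, ψ γ i z * ψ γ j z ∂μ = if i = j then 1 else 0) ∧
      Submodule.span ℝ (Set.range (ψ γ)) = eigenspace μ γ.2

/-- The contribution of the node `γ` to the heat kernel. -/
noncomputable def heatTerm (ψ : ∀ γ : Node A, Fin (eigenDim γ) → InfPath A → ℝ)
    (t : ℝ) (x y : InfPath A) (γ : Node A) : ℝ :=
  Real.exp (eigenvalue ρ κ δ s μ γ.2 * t) * ∑ j, ψ γ j x * ψ γ j y

/-- The heat kernel `p(t, x, y) = 1 + ∑_γ e^{λ_{s,γ} t} ∑_j ψ_{γ,j}(x) ψ_{γ,j}(y)`. -/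
noncomputable def heatKernel (ψ : ∀ γ : Node A, Fin (eigenDim γ) → InfPath A → ℝ)
    (t : ℝ) (x y : InfPath A) : ℝ :=
  1 + ∑' γ : Node A, heatTerm ρ κ δ s μ ψ t x y γ

end Heat

end Bratteli

namespace Bratteli

/-! Write `x_m` for `x.seg m`. Eigenfunctions at `γ` vanish off `[γ]`, so only the nodes `x_m`
contribute to `p(t,x,y)`. The sum over an orthonormal basis is the reproducing kernel of the
eigenspace, here the explicit `evalKernel`: `χ_[x_(m+1)]/μ[x_(m+1)] - χ_[x_m]/μ[x_m]`
(`sum_mul_eq_evalKernel`).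

On the diagonal its values are the increments of `1/μ[x_m]`. Since `G ≤ μ[γ]²/2`, one has `-λ ≥
2/μ[γ]` (`two_div_le_neg_eigenvalue`). The exponential then beats the growth of the kernel, and the
geometric decay of `μ[x_m]` gives convergence.

For (a), a point outside the ball leaves `x` at a depth `j` with `-λ_j t ≤ 1`. Let `J` be the finite
set of such depths. The ball has measure at least `1 - ∑_J (μ[x_j] - μ[x_(j+1)])`, while each `j ∈
J` contributes at least `e⁻¹` times the increment of `1/μ` to the kernel. The elementary inequality
`inv_le_one_add_sum_inv_sub_inv` compares the two for an arbitrary set of depths, so no monotonicity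
of `λ` along `x` is needed.

For (b), replacing the exponentials before the wedge by `1` gives a telescoping sum, and the wedge
term is negative. -/

/-- Put `T = 1 - ∑`. Lowering `T` by `d = m M - m (M+1)` to `T'` raises `1/T` by `d/(T' T)`, at most
`d/(m (M+1) * m M)` because `T ≥ m M` and `T' ≥ m (M+1)`. The first conclusion is the invariant that
carries this induction. -/
theorem inv_le_one_add_sum_inv_sub_inv {m : ℕ → ℝ} (hpos : ∀ n, 0 < m n)
    (hanti : ∀ n, m (n + 1) ≤ m n) (h0 : m 0 = 1) (p : ℕ → Prop) [DecidablePred p] (M : ℕ) :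
    m M ≤ 1 - ∑ j ∈ Finset.range M with p j, (m j - m (j + 1)) ∧
      (1 - ∑ j ∈ Finset.range M with p j, (m j - m (j + 1)))⁻¹ ≤
        1 + ∑ j ∈ Finset.range M with p j, ((m (j + 1))⁻¹ - (m j)⁻¹) := by
  induction M with
  | zero => simp [h0]
  | succ M ih =>
    obtain ⟨h1, h2⟩ := ih
    rw [Finset.sum_filter] at h1 h2 ⊢
    rw [Finset.sum_filter] at h2 ⊢
    rw [Finset.sum_range_succ, Finset.sum_range_succ]
    set S := ∑ j ∈ Finset.range M, if p j then m j - m (j + 1) else 0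
    set U := ∑ j ∈ Finset.range M, if p j then (m (j + 1))⁻¹ - (m j)⁻¹ else 0
    have hM := hpos M
    have hM' := hpos (M + 1)
    have hle := hanti M
    by_cases hp : p M
    · simp only [hp, if_true]
      refine ⟨by linarith, ?_⟩
      have hT : 0 < 1 - S := by linarith
      have hT' : m (M + 1) ≤ 1 - (S + (m M - m (M + 1))) := by linarith
      have hT0 : 0 < 1 - (S + (m M - m (M + 1))) := by linarith
      have e1 : (1 - (S + (m M - m (M + 1))))⁻¹ - (1 - S)⁻¹ =
          (m M - m (M + 1)) / ((1 - (S + (m M - m (M + 1)))) * (1 - S)) := by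
        rw [inv_sub_inv hT0.ne' hT.ne']
        congr 1
        ring
      have e2 : (m (M + 1))⁻¹ - (m M)⁻¹ = (m M - m (M + 1)) / (m (M + 1) * m M) :=
        inv_sub_inv hM'.ne' hM.ne'
      have : (m M - m (M + 1)) / ((1 - (S + (m M - m (M + 1)))) * (1 - S)) ≤
          (m M - m (M + 1)) / (m (M + 1) * m M) := by
        have := sub_nonneg.2 hle
        gcongr
      linarith
    · simp only [hp, if_false, add_zero]
      exact ⟨by linarith, h2⟩

/-! ### Infinite paths, initial pieces and cylinder sets. -/

variable {k : ℕ} [NeZero k] {V : Type u} {A : Fin k → Matrix V V ℕ}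

@[simp]
theorem InfPath.seg_take (x : InfPath A) {j m : ℕ} (h : j ≤ m) :
    (x.seg m).take j h = x.seg j := rfl

theorem InfPath.seg_eq_of_le {x y : InfPath A} {j m : ℕ} (h : j ≤ m) (hm : x.seg m = y.seg m) :
    x.seg j = y.seg j := by
  rw [← x.seg_take h, ← y.seg_take h, hm]

instance Seg.subsingleton_zero : Subsingleton (Seg A 0) := by
  refine ⟨?_⟩
  rintro ⟨v, e⟩ ⟨v', e'⟩
  obtain rfl : v = v' := Subsingleton.elim _ _
  congr
  funext i h
  omega

theorem InfPath.eq_of_forall_seg {x y : InfPath A} (h : ∀ m, x.seg m = y.seg m) : x = y := by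
  have hv : x.vert = y.vert := by
    funext n
    have := congrArg (fun s => Seg.vert s (Fin.last n)) (h (n + 1))
    simpa [InfPath.seg] using this
  obtain ⟨v, e⟩ := x
  obtain ⟨v', e'⟩ := y
  obtain rfl : v = v' := hv
  congr
  funext n
  have := h (n + 2)
  simp only [InfPath.seg, Seg.mk.injEq, true_and] at this
  exact congrFun (congrFun (eq_of_heq this) n) (by omega)

theorem mem_cyl_seg (x : InfPath A) (m : ℕ) : x ∈ cyl (x.seg m) := rfl

theorem mem_cyl {x : InfPath A} {m : ℕ} {γ : Seg A m} : x ∈ cyl γ ↔ x.seg m = γ := Iff.rfl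

theorem cyl_seg_antitone (x : InfPath A) {j m : ℕ} (h : j ≤ m) :
    cyl (x.seg m) ⊆ cyl (x.seg j) := fun _ hy => InfPath.seg_eq_of_le h hy

theorem measurableSet_cyl {m : ℕ} (γ : Seg A m) : MeasurableSet (cyl γ) :=
  have h : IsOpen (cyl γ) := TopologicalSpace.isOpen_generateFrom_of_mem ⟨m, γ, rfl⟩
  h.measurableSet

theorem cyl_zero (γ : Seg A 0) : cyl γ = Set.univ := by
  ext x
  simp only [Set.mem_univ, iff_true, mem_cyl]
  exact Subsingleton.elim _ _

/-- This makes the `sSup` in `wedgeDepth` an attained maximum rather than a default value. -/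
theorem bddAbove_setOf_seg_eq {x y : InfPath A} (h : x ≠ y) :
    BddAbove {m | x.seg m = y.seg m} := by
  by_contra hb
  refine h (InfPath.eq_of_forall_seg fun m => ?_)
  rw [not_bddAbove_iff] at hb
  obtain ⟨n, hn, hmn⟩ := hb m
  exact InfPath.seg_eq_of_le hmn.le hn

theorem seg_eq_iff_le_wedgeDepth {x y : InfPath A} (h : x ≠ y) (m : ℕ) :
    x.seg m = y.seg m ↔ m ≤ wedgeDepth x y := by
  refine ⟨fun hm => le_csSup (bddAbove_setOf_seg_eq h) hm, fun hm => ?_⟩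
  have hne : Set.Nonempty {m : ℕ | x.seg m = y.seg m} := ⟨0, Subsingleton.elim _ _⟩
  have : wedgeDepth x y ∈ {m | x.seg m = y.seg m} :=
    Nat.sSup_mem hne (bddAbove_setOf_seg_eq h)
  exact InfPath.seg_eq_of_le hm this

section Finite

variable [Finite V]

theorem mem_children {m : ℕ} {γ : Seg A m} {α : Seg A (m + 1)} :
    α ∈ children γ ↔ α.take m (Nat.le_succ m) = γ := by
  classical
  simp [children]

theorem seg_succ_mem_children (x : InfPath A) (m : ℕ) : x.seg (m + 1) ∈ children (x.seg m) :=
  mem_children.2 rfl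

theorem cyl_subset_of_mem_children {m : ℕ} {γ : Seg A m} {α : Seg A (m + 1)}
    (h : α ∈ children γ) : cyl α ⊆ cyl γ := by
  intro x hx
  rw [mem_cyl] at hx ⊢
  rw [← mem_children.1 h, ← hx, x.seg_take]

theorem sum_children_indicator {m : ℕ} (γ : Seg A m) (z : InfPath A) :
    ∑ α ∈ children γ, (cyl α).indicator (fun _ => (1 : ℝ)) z =
      (cyl γ).indicator (fun _ => 1) z := by
  classical
  by_cases hz : z ∈ cyl γ
  · rw [Finset.sum_eq_single (z.seg (m + 1))]
    · simp [hz, mem_cyl_seg]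
    · intro β _ hβ
      exact Set.indicator_of_notMem (fun h => hβ (mem_cyl.1 h).symm) _
    · intro h
      rw [mem_cyl] at hz
      subst hz
      exact absurd (seg_succ_mem_children z m) h
  · rw [Set.indicator_of_notMem hz]
    exact Finset.sum_eq_zero fun β hβ =>
      Set.indicator_of_notMem (fun h => hz (cyl_subset_of_mem_children hβ h)) _

theorem sum_children_measureReal (μ : Measure (InfPath A)) [IsFiniteMeasure μ] {m : ℕ}
    (γ : Seg A m) : ∑ α ∈ children γ, μ.real (cyl α) = μ.real (cyl γ) := by
  have h : ∀ {n : ℕ} (α : Seg A n),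
      μ.real (cyl α) = ∫ z, (cyl α).indicator (fun _ => (1 : ℝ)) z ∂μ := fun α => by
    simp [integral_indicator_const, measurableSet_cyl]
  simp only [h]
  rw [← integral_finsetSum _ fun α _ =>
    (integrable_const (1 : ℝ)).indicator (measurableSet_cyl α)]
  simp only [sum_children_indicator]

/-! ### Eigenspaces and their reproducing kernels. -/

section Eigenspace

variable {μ : Measure (InfPath A)} {m : ℕ} {γ : Seg A m} {f : InfPath A → ℝ}

theorem memLp_of_mem_eigenspace [IsFiniteMeasure μ] (hf : f ∈ eigenspace μ γ) : MemLp f 2 μ := by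
  induction hf using Submodule.span_induction with
  | mem f hf =>
    obtain ⟨α, -, β, -, -, rfl⟩ := hf
    exact (memLp_indicator_const _ (measurableSet_cyl α) _ (Or.inr (measure_ne_top _ _))).sub
      (memLp_indicator_const _ (measurableSet_cyl β) _ (Or.inr (measure_ne_top _ _)))
  | zero => exact MemLp.zero
  | add f g _ _ hf hg => exact hf.add hg
  | smul c f _ hf => exact hf.const_smul c

theorem eq_zero_of_mem_eigenspace (hf : f ∈ eigenspace μ γ) {z : InfPath A} (hz : z ∉ cyl γ) :
    f z = 0 := by
  induction hf using Submodule.span_induction with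
  | mem f hf =>
    obtain ⟨α, hα, β, hβ, -, rfl⟩ := hf
    rw [Pi.sub_apply, Set.indicator_of_notMem fun h => hz (cyl_subset_of_mem_children hα h),
      Set.indicator_of_notMem fun h => hz (cyl_subset_of_mem_children hβ h), sub_zero]
  | zero => rfl
  | add f g _ _ hf hg => simp [hf, hg]
  | smul c f _ hf => simp [hf]

theorem eq_of_mem_eigenspace (hf : f ∈ eigenspace μ γ) {x z : InfPath A}
    (h : z.seg (m + 1) = x.seg (m + 1)) : f z = f x := by
  classical
  induction hf using Submodule.span_induction with
  | mem f hf =>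
    obtain ⟨α, hα, β, hβ, -, rfl⟩ := hf
    simp only [Pi.sub_apply, Set.indicator_apply, mem_cyl, h]
  | zero => rfl
  | add f g _ _ hf hg => simp [hf, hg]
  | smul c f _ hf => simp [hf]

theorem integral_of_mem_eigenspace [IsFiniteMeasure μ]
    (hpos : ∀ (n : ℕ) (α : Seg A n), 0 < μ.real (cyl α)) (hf : f ∈ eigenspace μ γ) :
    ∫ z, f z ∂μ = 0 := by
  induction hf using Submodule.span_induction with
  | mem f hf =>
    obtain ⟨α, hα, β, hβ, -, rfl⟩ := hf
    have h (n : ℕ) (α : Seg A n) :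
        ∫ z, (cyl α).indicator (fun _ => 1 / μ.real (cyl α)) z ∂μ = 1 := by
      rw [integral_indicator_const _ (measurableSet_cyl α), smul_eq_mul,
        mul_one_div_cancel (hpos n α).ne']
    simp only [Pi.sub_apply]
    rw [integral_sub ((integrable_const _).indicator (measurableSet_cyl α))
      ((integrable_const _).indicator (measurableSet_cyl β)), h, h, sub_self]
  | zero => simp
  | add f g hf' hg' hf hg =>
    simp only [Pi.add_apply]
    rw [integral_add ((memLp_of_mem_eigenspace hf').integrable (by norm_num))
      ((memLp_of_mem_eigenspace hg').integrable (by norm_num)), hf, hg, add_zero]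
  | smul c f _ hf => simp [integral_const_mul, hf]

/-- The function of the eigenspace of `x.seg m` that represents the evaluation at `x`. -/
noncomputable def evalKernel (μ : Measure (InfPath A)) (m : ℕ) (x : InfPath A) : InfPath A → ℝ :=
  fun z => (μ.real (cyl (x.seg (m + 1))))⁻¹ * (cyl (x.seg (m + 1))).indicator (fun _ => 1) z -
    (μ.real (cyl (x.seg m)))⁻¹ * (cyl (x.seg m)).indicator (fun _ => 1) z

theorem evalKernel_mem_eigenspace [IsFiniteMeasure μ]
    (hpos : ∀ (n : ℕ) (α : Seg A n), 0 < μ.real (cyl α)) (m : ℕ) (x : InfPath A) :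
    evalKernel μ m x ∈ eigenspace μ (x.seg m) := by
  classical
  -- An average of generators with weights `μ[β]/μ[x.seg m]` of total `1`; the weights cancel the
  -- normalisation of `χ_[β]`, so the second parts add up to the indicator of the parent cylinder.
  have h : evalKernel μ m x = ∑ β ∈ children (x.seg m),
      (μ.real (cyl β) / μ.real (cyl (x.seg m))) •
        ((cyl (x.seg (m + 1))).indicator (fun _ => 1 / μ.real (cyl (x.seg (m + 1)))) -
          (cyl β).indicator (fun _ => 1 / μ.real (cyl β))) := by
    have hind : ∀ {n : ℕ} (α : Seg A n) (z : InfPath A),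
        (cyl α).indicator (fun _ => 1 / μ.real (cyl α)) z =
          (μ.real (cyl α))⁻¹ * (cyl α).indicator (fun _ => 1) z := fun α z => by
      by_cases hz : z ∈ cyl α <;> simp [hz]
    funext z
    simp only [Finset.sum_apply, Pi.smul_apply, Pi.sub_apply, smul_eq_mul, hind, mul_sub,
      Finset.sum_sub_distrib, ← Finset.sum_mul, ← Finset.sum_div, sum_children_measureReal,
      evalKernel]
    rw [div_self (hpos _ _).ne', one_mul, ← sum_children_indicator (x.seg m), Finset.mul_sum]
    congr 1
    refine Finset.sum_congr rfl fun β _ => ?_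
    have := (hpos _ β).ne'
    field_simp
  rw [h]
  refine Submodule.sum_mem _ fun β hβ => Submodule.smul_mem _ _ ?_
  -- Generators need distinct extensions; the term with equal ones is zero.
  by_cases hβx : x.seg (m + 1) = β
  · subst hβx
    simp
  · exact Submodule.subset_span ⟨_, seg_succ_mem_children x m, β, hβ, hβx, rfl⟩

/-- `f` is constant on the child cylinder of `x`, and it is supported in the parent cylinder with
mean zero, so the parent term integrates to `0`. -/
theorem integral_mul_evalKernel [IsFiniteMeasure μ]
    (hpos : ∀ (n : ℕ) (α : Seg A n), 0 < μ.real (cyl α)) (x : InfPath A)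
    (hf : f ∈ eigenspace μ (x.seg m)) : ∫ z, f z * evalKernel μ m x z ∂μ = f x := by
  have h : ∀ z, f z * evalKernel μ m x z =
      (cyl (x.seg (m + 1))).indicator (fun _ => (μ.real (cyl (x.seg (m + 1))))⁻¹ * f x) z -
        (μ.real (cyl (x.seg m)))⁻¹ * f z := by
    intro z
    unfold evalKernel
    by_cases h0 : z ∈ cyl (x.seg m)
    · by_cases h1 : z ∈ cyl (x.seg (m + 1))
      · rw [eq_of_mem_eigenspace hf h1]
        simp [h0, h1]
        ring
      · simp [h0, h1]
        ring
    · have h1 : z ∉ cyl (x.seg (m + 1)) := fun h => h0 (cyl_seg_antitone x (Nat.le_succ m) h)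
      simp [h0, h1, eq_zero_of_mem_eigenspace hf h0]
  simp only [h]
  rw [integral_sub ((integrable_const _).indicator (measurableSet_cyl _))
    (((memLp_of_mem_eigenspace hf).integrable (by norm_num)).const_mul _),
    integral_const_mul, integral_of_mem_eigenspace hpos hf,
    integral_indicator_const _ (measurableSet_cyl _), smul_eq_mul,
    mul_inv_cancel_left₀ (hpos _ _).ne', mul_zero, sub_zero]

variable {ψ : ∀ γ : Node A, Fin (eigenDim γ) → InfPath A → ℝ}

theorem IsEigenbasis.mem (hψ : IsEigenbasis μ ψ) (γ : Node A) (j : Fin (eigenDim γ)) :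
    ψ γ j ∈ eigenspace μ γ.2 := by
  rw [← (hψ γ).2]
  exact Submodule.subset_span ⟨j, rfl⟩

/-- Expand the kernel in the orthonormal basis: by the reproducing property its `i`-th coefficient
is `ψ_i(x)`. -/
theorem IsEigenbasis.sum_mul_eq_evalKernel [IsFiniteMeasure μ] (hψ : IsEigenbasis μ ψ)
    (hpos : ∀ (n : ℕ) (α : Seg A n), 0 < μ.real (cyl α)) (m : ℕ) (x y : InfPath A) :
    ∑ j, ψ ⟨m, x.seg m⟩ j x * ψ ⟨m, x.seg m⟩ j y = evalKernel μ m x y := by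
  have hmem := evalKernel_mem_eigenspace hpos m x
  have hspan := (hψ ⟨m, x.seg m⟩).2
  have hon := (hψ ⟨m, x.seg m⟩).1
  have hψm := hψ.mem ⟨m, x.seg m⟩
  rw [← hspan, Submodule.mem_span_range_iff_exists_fun] at hmem
  obtain ⟨c, hc⟩ := hmem
  have hcoef : ∀ i, ψ ⟨m, x.seg m⟩ i x = c i := by
    intro i
    rw [← integral_mul_evalKernel hpos x (hψm i), ← hc]
    simp only [Finset.sum_apply, Pi.smul_apply, smul_eq_mul, Finset.mul_sum, mul_left_comm _ (c _)]
    have hint (j) : Integrable (fun z => c j * (ψ ⟨m, x.seg m⟩ i z * ψ ⟨m, x.seg m⟩ j z)) μ :=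
      ((memLp_of_mem_eigenspace (hψm i)).integrable_mul
        (memLp_of_mem_eigenspace (hψm j))).const_mul _
    rw [integral_finsetSum _ fun j _ => hint j]
    simp [integral_const_mul, hon]
  rw [← hc]
  simp [hcoef]

end Eigenspace

end Finite

/-! ### Estimates for weights, measures and kernel values along a path. -/

section Estimates

variable {k : ℕ} [NeZero k] {V : Type u} {A : Fin k → Matrix V V ℕ}
  {ρ : Fin k → ℝ} {κ : V → ℝ} {δ s : ℝ} {μ : Measure (InfPath A)}

theorem one_le_levelProd (hρ : ∀ i, 1 < ρ i) (n : ℕ) : 1 ≤ levelProd ρ n :=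
  Finset.prod_induction _ (fun a => 1 ≤ a) (fun _ _ => one_le_mul_of_one_le_of_one_le) le_rfl
    fun _ _ => (hρ _).le

theorem levelProd_pos (hρ : ∀ i, 1 < ρ i) (n : ℕ) : 0 < levelProd ρ n :=
  one_pos.trans_le (one_le_levelProd hρ n)

theorem weight_pos (hρ : ∀ i, 1 < ρ i) (hκ : ∀ v, 0 < κ v) :
    ∀ {m : ℕ} (γ : Seg A m), 0 < weight ρ κ δ γ
  | 0, _ => one_pos
  | n + 1, _ => mul_pos (Real.rpow_pos_of_pos (levelProd_pos hρ n) _) (hκ _)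

theorem weight_le_one (hρ : ∀ i, 1 < ρ i) (hκ : ∀ v, 0 < κ v) (hκ1 : ∀ v, κ v ≤ 1)
    (hδ : 0 < δ) : ∀ {m : ℕ} (γ : Seg A m), weight ρ κ δ γ ≤ 1
  | 0, _ => le_rfl
  | n + 1, _ => mul_le_one₀ (Real.rpow_le_one_of_one_le_of_nonpos (one_le_levelProd hρ n)
      (div_nonpos_of_nonpos_of_nonneg (by norm_num) hδ.le)) (hκ _).le (hκ1 _)

theorem IsSelfSimilar.measureReal_cyl_zero (hμ : IsSelfSimilar ρ κ μ) (γ : Seg A 0) :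
    μ.real (cyl γ) = 1 := by
  have := hμ.1
  rw [cyl_zero, probReal_univ]

theorem IsSelfSimilar.measureReal_cyl_pos (hμ : IsSelfSimilar ρ κ μ) (hρ : ∀ i, 1 < ρ i)
    (hκ : ∀ v, 0 < κ v) : ∀ (m : ℕ) (γ : Seg A m), 0 < μ.real (cyl γ)
  | 0, γ => by simp [hμ.measureReal_cyl_zero γ]
  | n + 1, γ => by
    rw [hμ.2]
    exact mul_pos (inv_pos.2 (levelProd_pos hρ n)) (hκ _)

theorem IsSelfSimilar.measureReal_cyl_le_one (hμ : IsSelfSimilar ρ κ μ) {m : ℕ} (γ : Seg A m) :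
    μ.real (cyl γ) ≤ 1 := by
  have := hμ.1
  exact measureReal_le_one

theorem IsSelfSimilar.measureReal_cyl_seg_succ_le (hμ : IsSelfSimilar ρ κ μ) (x : InfPath A)
    (m : ℕ) : μ.real (cyl (x.seg (m + 1))) ≤ μ.real (cyl (x.seg m)) := by
  have := hμ.1
  exact measureReal_mono (cyl_seg_antitone x (Nat.le_succ m))

theorem IsSelfSimilar.summable_measureReal_cyl (hμ : IsSelfSimilar ρ κ μ) (hρ : ∀ i, 1 < ρ i)
    (hκ1 : ∀ v, κ v ≤ 1) (x : InfPath A) :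
    Summable fun m => μ.real (cyl (x.seg m)) := by
  obtain ⟨i, hi⟩ := Finite.exists_min ρ
  rw [← summable_nat_add_iff 1]
  refine Summable.of_nonneg_of_le (fun _ => measureReal_nonneg) (fun n => ?_)
    (summable_geometric_of_lt_one (inv_pos.2 (one_pos.trans (hρ i))).le (inv_lt_one_of_one_lt₀ (hρ i)))
  have hpow : ρ i ^ n ≤ levelProd ρ n := by
    have := Finset.prod_le_prod (s := Finset.range n) (f := fun _ => ρ i)
      (g := fun j => ρ (color k j)) (fun _ _ => (one_pos.trans (hρ i)).le) fun _ _ => hi _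
    simpa [levelProd] using this
  have hpos : 0 < ρ i ^ n := pow_pos (one_pos.trans (hρ i)) n
  rw [hμ.2, inv_pow]
  calc (levelProd ρ n)⁻¹ * κ _ ≤ (levelProd ρ n)⁻¹ * 1 := by
        have := levelProd_pos hρ n
        gcongr
        exact hκ1 _
    _ ≤ (ρ i ^ n)⁻¹ := by
        rw [mul_one]
        gcongr

theorem evalKernel_self (m : ℕ) (x : InfPath A) :
    evalKernel μ m x x = (μ.real (cyl (x.seg (m + 1))))⁻¹ - (μ.real (cyl (x.seg m)))⁻¹ := by
  simp [evalKernel, mem_cyl_seg]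

theorem evalKernel_self_nonneg (hμ : IsSelfSimilar ρ κ μ) (hρ : ∀ i, 1 < ρ i)
    (hκ : ∀ v, 0 < κ v) (m : ℕ) (x : InfPath A) : 0 ≤ evalKernel μ m x x := by
  rw [evalKernel_self, sub_nonneg]
  exact inv_anti₀ (hμ.measureReal_cyl_pos hρ hκ _ _) (hμ.measureReal_cyl_seg_succ_le x m)

theorem evalKernel_of_lt_wedgeDepth {x y : InfPath A} (h : x ≠ y) {m : ℕ}
    (hm : m < wedgeDepth x y) :
    evalKernel μ m x y = (μ.real (cyl (x.seg (m + 1))))⁻¹ - (μ.real (cyl (x.seg m)))⁻¹ := by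
  have h1 : y ∈ cyl (x.seg m) := ((seg_eq_iff_le_wedgeDepth h _).2 hm.le).symm
  have h2 : y ∈ cyl (x.seg (m + 1)) := ((seg_eq_iff_le_wedgeDepth h _).2 hm).symm
  simp [evalKernel, h1, h2]

theorem evalKernel_wedgeDepth {x y : InfPath A} (h : x ≠ y) :
    evalKernel μ (wedgeDepth x y) x y = -(μ.real (cyl (x.seg (wedgeDepth x y))))⁻¹ := by
  have h1 : y ∈ cyl (x.seg (wedgeDepth x y)) := ((seg_eq_iff_le_wedgeDepth h _).2 le_rfl).symm
  have h2 : y ∉ cyl (x.seg (wedgeDepth x y + 1)) := fun hy => by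
    have := (seg_eq_iff_le_wedgeDepth h _).1 (mem_cyl.1 hy).symm
    omega
  simp [evalKernel, h1, h2]

theorem evalKernel_of_wedgeDepth_lt {x y : InfPath A} (h : x ≠ y) {m : ℕ}
    (hm : wedgeDepth x y < m) : evalKernel μ m x y = 0 := by
  have h1 : ∀ n, wedgeDepth x y < n → y ∉ cyl (x.seg n) := fun n hn hy => by
    have := (seg_eq_iff_le_wedgeDepth h _).1 (mem_cyl.1 hy).symm
    omega
  simp [evalKernel, h1 m hm, h1 (m + 1) (by omega)]

theorem seg_node_injective (x : InfPath A) :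
    Function.Injective fun m => (⟨m, x.seg m⟩ : Node A) :=
  fun _ _ h => congrArg Sigma.fst h

section Finite

variable [Finite V]

theorem IsSelfSimilar.exists_inv_measureReal_cyl_le (hμ : IsSelfSimilar ρ κ μ)
    (hρ : ∀ i, 1 < ρ i) (hκ : ∀ v, 0 < κ v) (hκ1 : ∀ v, κ v ≤ 1) :
    ∃ C, 0 ≤ C ∧ ∀ (n : ℕ) (x : InfPath A),
      (μ.real (cyl (x.seg (n + 2))))⁻¹ ≤ C * (μ.real (cyl (x.seg (n + 1))))⁻¹ := by
  obtain ⟨R, hR⟩ := (Set.finite_range ρ).bddAbove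
  obtain ⟨c, hc⟩ := (Set.finite_range fun v => (κ v)⁻¹).bddAbove
  have hR' : ∀ i, ρ i ≤ R := fun i => hR ⟨i, rfl⟩
  have hR0 : 0 ≤ R := (one_pos.trans (hρ (color k 0))).le.trans (hR' _)
  -- One more level costs a factor `ρ_i ≤ R` and a new `1/κ ≤ |c|`; the old `1/κ` is at least `1`.
  -- The absolute value gives nonnegativity without a vertex at hand.
  refine ⟨R * |c|, by positivity, fun n x => ?_⟩
  rw [hμ.2, hμ.2, mul_inv, mul_inv, inv_inv, inv_inv, levelProd, Finset.prod_range_succ]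
  have h1 : ∀ v, (κ v)⁻¹ ≤ |c| := fun v => (hc ⟨v, rfl⟩).trans (le_abs_self c)
  have h2 := levelProd_pos hρ n
  have h3 : ∀ v, 1 ≤ (κ v)⁻¹ := fun v => (one_le_inv₀ (hκ v)).2 (hκ1 v)
  change levelProd ρ n * _ * _ ≤ _
  have h4 : levelProd ρ n * ρ (color k n) * (κ ((x.seg (n + 2)).vert (Fin.last (n + 1))))⁻¹ ≤
      levelProd ρ n * R * |c| := by
    have := (inv_pos.2 (hκ ((x.seg (n + 2)).vert (Fin.last (n + 1))))).le
    exact mul_le_mul (mul_le_mul_of_nonneg_left (hR' _) h2.le) (h1 _) this (by positivity)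
  calc _ ≤ levelProd ρ n * R * |c| := h4
    _ ≤ levelProd ρ n * R * |c| * (κ ((x.seg (n + 1)).vert (Fin.last n)))⁻¹ :=
        le_mul_of_one_le_right (by positivity) (h3 _)
    _ = _ := by ring

/-! ### Bounds for `G` and the eigenvalues; diagonal convergence. -/

theorem G_nonneg (hρ : ∀ i, 1 < ρ i) (hκ : ∀ v, 0 < κ v) {m : ℕ} (γ : Seg A m) :
    0 ≤ G ρ κ δ s μ γ :=
  mul_nonneg (mul_nonneg (by norm_num) (Real.rpow_nonneg (weight_pos hρ hκ γ).le _))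
    (Finset.sum_nonneg fun _ _ => mul_nonneg measureReal_nonneg measureReal_nonneg)

theorem G_pos (hμ : IsSelfSimilar ρ κ μ) (hρ : ∀ i, 1 < ρ i) (hκ : ∀ v, 0 < κ v) {m : ℕ}
    {γ : Seg A m} {α β : Seg A (m + 1)} (hα : α ∈ children γ) (hβ : β ∈ children γ)
    (h : α ≠ β) : 0 < G ρ κ δ s μ γ := by
  have hpos := hμ.measureReal_cyl_pos hρ hκ
  refine mul_pos (mul_pos (by norm_num) (Real.rpow_pos_of_pos (weight_pos hρ hκ γ) _)) ?_
  refine Finset.sum_pos (fun p _ => mul_pos (hpos _ _) (hpos _ _)) ⟨(α, β), ?_⟩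
  simp [hα, hβ, h]

/-- An only extension inherits the whole measure, so a drop forces a second one. -/
theorem G_seg_pos_of_measureReal_ne (hμ : IsSelfSimilar ρ κ μ) (hρ : ∀ i, 1 < ρ i)
    (hκ : ∀ v, 0 < κ v) {m : ℕ} {x : InfPath A}
    (h : μ.real (cyl (x.seg (m + 1))) ≠ μ.real (cyl (x.seg m))) :
    0 < G ρ κ δ s μ (x.seg m) := by
  have := hμ.1
  have hx := seg_succ_mem_children x m
  by_contra hG
  have hsing : children (x.seg m) = {x.seg (m + 1)} :=
    Finset.eq_singleton_iff_unique_mem.2 ⟨hx, fun α hα => by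
      by_contra hne
      exact hG (G_pos hμ hρ hκ hα hx hne)⟩
  apply h
  rw [← sum_children_measureReal μ (x.seg m), hsing, Finset.sum_singleton]

theorem G_seg_wedgeDepth_pos (hμ : IsSelfSimilar ρ κ μ) (hρ : ∀ i, 1 < ρ i)
    (hκ : ∀ v, 0 < κ v) {x y : InfPath A} (h : x ≠ y) :
    0 < G ρ κ δ s μ (x.seg (wedgeDepth x y)) := by
  have hy := seg_succ_mem_children y (wedgeDepth x y)
  rw [← (seg_eq_iff_le_wedgeDepth h _).2 le_rfl] at hy
  refine G_pos hμ hρ hκ (seg_succ_mem_children x _) hy fun he => ?_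
  have := (seg_eq_iff_le_wedgeDepth h _).1 he
  omega

/-- With the diagonal pairs included the double sum is `μ[γ]²`; `s < 2` turns `w ≤ 1` into `w^(2-s)
≤ 1`. -/
theorem G_le (hμ : IsSelfSimilar ρ κ μ) (hρ : ∀ i, 1 < ρ i) (hκ : ∀ v, 0 < κ v)
    (hκ1 : ∀ v, κ v ≤ 1) (hδ : 0 < δ) (hs : s < 2) {m : ℕ} (γ : Seg A m) :
    G ρ κ δ s μ γ ≤ 1 / 2 * μ.real (cyl γ) ^ 2 := by
  classical
  have := hμ.1
  have hw : weight ρ κ δ γ ^ (2 - s) ≤ 1 :=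
    Real.rpow_le_one (weight_pos hρ hκ γ).le (weight_le_one hρ hκ hκ1 hδ γ) (by linarith)
  have hsum : ∑ p ∈ (children γ ×ˢ children γ).filter (fun p => p.1 ≠ p.2),
      μ.real (cyl p.1) * μ.real (cyl p.2) ≤ μ.real (cyl γ) ^ 2 := by
    rw [← sum_children_measureReal μ γ, sq, Finset.sum_mul_sum, ← Finset.sum_product']
    exact Finset.sum_le_sum_of_subset_of_nonneg (Finset.filter_subset _ _)
      fun _ _ _ => mul_nonneg measureReal_nonneg measureReal_nonneg
  unfold G
  refine mul_le_mul (by linarith) ?_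
    (Finset.sum_nonneg fun _ _ => mul_nonneg measureReal_nonneg measureReal_nonneg) (by norm_num)
  convert hsum

theorem div_G_le_neg_eigenvalue (hμ : IsSelfSimilar ρ κ μ) (hρ : ∀ i, 1 < ρ i)
    (hκ : ∀ v, 0 < κ v) (x : InfPath A) (m : ℕ) :
    μ.real (cyl (x.seg m)) / G ρ κ δ s μ (x.seg m) ≤ -eigenvalue ρ κ δ s μ (x.seg m) := by
  unfold eigenvalue
  have : (∑ j : Fin m, (μ.real (cyl ((x.seg m).take (j + 1) j.isLt)) -
      μ.real (cyl ((x.seg m).take j j.isLt.le))) /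
        G ρ κ δ s μ ((x.seg m).take j j.isLt.le)) ≤ 0 :=
    Finset.sum_nonpos fun j _ => div_nonpos_of_nonpos_of_nonneg
      (sub_nonpos.2 (hμ.measureReal_cyl_seg_succ_le x j)) (G_nonneg hρ hκ _)
  linarith

theorem eigenvalue_seg_nonpos (hμ : IsSelfSimilar ρ κ μ) (hρ : ∀ i, 1 < ρ i)
    (hκ : ∀ v, 0 < κ v) (x : InfPath A) (m : ℕ) : eigenvalue ρ κ δ s μ (x.seg m) ≤ 0 := by
  have h1 := div_G_le_neg_eigenvalue (δ := δ) (s := s) hμ hρ hκ x m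
  have h2 : 0 ≤ μ.real (cyl (x.seg m)) / G ρ κ δ s μ (x.seg m) :=
    div_nonneg measureReal_nonneg (G_nonneg hρ hκ _)
  linarith

theorem two_div_le_neg_eigenvalue (hμ : IsSelfSimilar ρ κ μ) (hρ : ∀ i, 1 < ρ i)
    (hκ : ∀ v, 0 < κ v) (hκ1 : ∀ v, κ v ≤ 1) (hδ : 0 < δ) (hs : s < 2) {x : InfPath A} {m : ℕ}
    (hG : 0 < G ρ κ δ s μ (x.seg m)) :
    2 / μ.real (cyl (x.seg m)) ≤ -eigenvalue ρ κ δ s μ (x.seg m) := by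
  refine le_trans ?_ (div_G_le_neg_eigenvalue hμ hρ hκ x m)
  rw [div_le_div_iff₀ (hμ.measureReal_cyl_pos hρ hκ _ _) hG]
  have := G_le hμ hρ hκ hκ1 hδ hs (x.seg m)
  nlinarith

theorem summable_exp_mul_evalKernel_self (hμ : IsSelfSimilar ρ κ μ) (hρ : ∀ i, 1 < ρ i)
    (hκ : ∀ v, 0 < κ v) (hκ1 : ∀ v, κ v ≤ 1) (hδ : 0 < δ) (hs : s < 2) {t : ℝ} (ht : 0 < t)
    (x : InfPath A) :
    Summable fun m => Real.exp (eigenvalue ρ κ δ s μ (x.seg m) * t) * evalKernel μ m x x := by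
  obtain ⟨C, hC0, hC⟩ := hμ.exists_inv_measureReal_cyl_le hρ hκ hκ1
  rw [← summable_nat_add_iff 1]
  have hsum := (summable_nat_add_iff 1).2 (hμ.summable_measureReal_cyl hρ hκ1 x)
  refine Summable.of_nonneg_of_le
    (fun n => mul_nonneg (Real.exp_pos _).le (evalKernel_self_nonneg hμ hρ hκ _ x))
    (fun n => ?_) (hsum.mul_left (C / (2 * t ^ 2)))
  have hpos := hμ.measureReal_cyl_pos hρ hκ (n + 1) (x.seg (n + 1))
  -- If no mass is lost the kernel vanishes; this covers nodes with `G = 0`, where the eigenvalue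
  -- bound is not available.
  by_cases h0 : μ.real (cyl (x.seg (n + 1 + 1))) = μ.real (cyl (x.seg (n + 1)))
  · rw [evalKernel_self, h0, sub_self, mul_zero]
    positivity
  have hG : 0 < G ρ κ δ s μ (x.seg (n + 1)) := G_seg_pos_of_measureReal_ne hμ hρ hκ h0
  have ha := two_div_le_neg_eigenvalue hμ hρ hκ hκ1 hδ hs hG
  set a := μ.real (cyl (x.seg (n + 1)))
  -- One power of `a` absorbs the kernel bound `C/a`, and the other keeps the series summable.
  have hexp : Real.exp (eigenvalue ρ κ δ s μ (x.seg (n + 1)) * t) ≤ a ^ 2 / (2 * t ^ 2) := by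
    have hz : 0 ≤ 2 / a * t := by positivity
    calc Real.exp (eigenvalue ρ κ δ s μ (x.seg (n + 1)) * t) ≤ Real.exp (-(2 / a * t)) := by
          rw [Real.exp_le_exp]
          nlinarith
      _ = (Real.exp (2 / a * t))⁻¹ := Real.exp_neg _
      _ ≤ ((2 / a * t) ^ 2 / 2)⁻¹ := by
          have := Real.quadratic_le_exp_of_nonneg hz
          refine inv_anti₀ (by positivity) (by linarith)
      _ = a ^ 2 / (2 * t ^ 2) := by
          field_simp
  have hK : evalKernel μ (n + 1) x x ≤ C * a⁻¹ := by
    rw [evalKernel_self]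
    have := hC n x
    have := inv_pos.2 hpos
    linarith
  calc _ ≤ a ^ 2 / (2 * t ^ 2) * (C * a⁻¹) :=
        mul_le_mul hexp hK (evalKernel_self_nonneg hμ hρ hκ _ x) (by positivity)
    _ = C / (2 * t ^ 2) * a := by
        field_simp

/-! ### The heat kernel: reduction to one path, convergence and the two bounds. -/

section HeatKernel

variable {ψ : ∀ γ : Node A, Fin (eigenDim γ) → InfPath A → ℝ}

theorem heatTerm_eq_zero (hψ : IsEigenbasis μ ψ) (t : ℝ) (x y : InfPath A) {γ : Node A}
    (h : γ ∉ Set.range fun m => (⟨m, x.seg m⟩ : Node A)) : heatTerm ρ κ δ s μ ψ t x y γ = 0 := by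
  have hx : x ∉ cyl γ.2 := fun hx => h ⟨γ.1, Sigma.ext rfl (heq_of_eq (mem_cyl.1 hx))⟩
  simp [heatTerm, eq_zero_of_mem_eigenspace (hψ.mem γ _) hx]

theorem heatTerm_seg (hμ : IsSelfSimilar ρ κ μ) (hρ : ∀ i, 1 < ρ i) (hκ : ∀ v, 0 < κ v)
    (hψ : IsEigenbasis μ ψ) (t : ℝ) (x y : InfPath A) (m : ℕ) :
    heatTerm ρ κ δ s μ ψ t x y ⟨m, x.seg m⟩ =
      Real.exp (eigenvalue ρ κ δ s μ (x.seg m) * t) * evalKernel μ m x y := by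
  have := hμ.1
  rw [heatTerm, hψ.sum_mul_eq_evalKernel (hμ.measureReal_cyl_pos hρ hκ)]

theorem summable_heatTerm_iff (hμ : IsSelfSimilar ρ κ μ) (hρ : ∀ i, 1 < ρ i)
    (hκ : ∀ v, 0 < κ v) (hψ : IsEigenbasis μ ψ) (t : ℝ) (x y : InfPath A) :
    Summable (heatTerm ρ κ δ s μ ψ t x y) ↔
      Summable fun m => Real.exp (eigenvalue ρ κ δ s μ (x.seg m) * t) * evalKernel μ m x y := by
  rw [← (seg_node_injective x).summable_iff fun γ hγ => heatTerm_eq_zero hψ t x y hγ]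
  simp only [Function.comp_def, heatTerm_seg hμ hρ hκ hψ]

theorem heatKernel_eq (hμ : IsSelfSimilar ρ κ μ) (hρ : ∀ i, 1 < ρ i)
    (hκ : ∀ v, 0 < κ v) (hψ : IsEigenbasis μ ψ) (t : ℝ) (x y : InfPath A) :
    heatKernel ρ κ δ s μ ψ t x y =
      1 + ∑' m, Real.exp (eigenvalue ρ κ δ s μ (x.seg m) * t) * evalKernel μ m x y := by
  have hsupp : Function.support (heatTerm ρ κ δ s μ ψ t x y) ⊆
      Set.range fun m => (⟨m, x.seg m⟩ : Node A) := fun γ hγ => by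
    by_contra h
    exact hγ (heatTerm_eq_zero hψ t x y h)
  rw [heatKernel, ← (seg_node_injective x).tsum_eq hsupp]
  simp only [heatTerm_seg hμ hρ hκ hψ]

theorem summable_heatTerm (hμ : IsSelfSimilar ρ κ μ) (hρ : ∀ i, 1 < ρ i)
    (hκ : ∀ v, 0 < κ v) (hκ1 : ∀ v, κ v ≤ 1) (hδ : 0 < δ) (hs : s < 2) (hψ : IsEigenbasis μ ψ)
    {t : ℝ} (ht : 0 < t) (x y : InfPath A) : Summable (heatTerm ρ κ δ s μ ψ t x y) := by
  rw [summable_heatTerm_iff hμ hρ hκ hψ]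
  by_cases hxy : x = y
  · subst hxy
    exact summable_exp_mul_evalKernel_self hμ hρ hκ hκ1 hδ hs ht x
  · refine summable_of_ne_finset_zero (s := Finset.range (wedgeDepth x y + 1)) fun m hm => ?_
    rw [evalKernel_of_wedgeDepth_lt hxy (by simpa using hm), mul_zero]

theorem neg_eigenvalue_mul_le_one_of_notMem_intrinsicBall (hμ : IsSelfSimilar ρ κ μ)
    (hρ : ∀ i, 1 < ρ i) (hκ : ∀ v, 0 < κ v) {t : ℝ} (ht : 0 < t) {x y : InfPath A}
    (h : y ∉ intrinsicBall ρ κ δ s μ x t) :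
    x ≠ y ∧ -eigenvalue ρ κ δ s μ (x.seg (wedgeDepth x y)) * t ≤ 1 := by
  have hxy : x ≠ y := by
    rintro rfl
    exact h (by simpa [intrinsicBall, intrinsicDist] using ht)
  refine ⟨hxy, ?_⟩
  have h' : t ≤ -1 / eigenvalue ρ κ δ s μ (x.seg (wedgeDepth x y)) := by
    simpa [intrinsicBall, intrinsicDist, hxy, wedge] using h
  have hle := eigenvalue_seg_nonpos (δ := δ) (s := s) hμ hρ hκ x (wedgeDepth x y)
  rcases hle.lt_or_eq with h0 | h0
  · rw [← neg_div_neg_eq, neg_neg, le_div_iff₀ (neg_pos.2 h0)] at h'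
    linarith
  · rw [h0]
    norm_num

theorem le_heatKernel_self (hμ : IsSelfSimilar ρ κ μ) (hρ : ∀ i, 1 < ρ i)
    (hκ : ∀ v, 0 < κ v) (hκ1 : ∀ v, κ v ≤ 1) (hδ : 0 < δ) (hs : s < 2) (hψ : IsEigenbasis μ ψ)
    {t : ℝ} (ht : 0 < t) (x : InfPath A) :
    1 / Real.exp 1 * (1 / μ.real (intrinsicBall ρ κ δ s μ x t)) ≤
      heatKernel ρ κ δ s μ ψ t x x := by
  classical
  have := hμ.1
  let p : ℕ → Prop := fun j =>
    0 < G ρ κ δ s μ (x.seg j) ∧ -eigenvalue ρ κ δ s μ (x.seg j) * t ≤ 1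
  -- Once `μ[x_j] < 2t`, the bound `-λ_j ≥ 2/μ[x_j]` gives `-λ_j t > 1`.
  obtain ⟨M, hM⟩ : ∃ M, ∀ j, p j → j < M := by
    have hlim := (hμ.summable_measureReal_cyl hρ hκ1 x).tendsto_atTop_zero
    have h2t : (0 : ℝ) < 2 * t := by linarith
    obtain ⟨M, hM⟩ := Filter.eventually_atTop.1 (hlim.eventually_lt_const h2t)
    refine ⟨M, fun j ⟨hG, hj⟩ => ?_⟩
    by_contra! hMj
    have hlt := hM j hMj
    have hpos := hμ.measureReal_cyl_pos hρ hκ j (x.seg j)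
    have h1 := two_div_le_neg_eigenvalue hμ hρ hκ hκ1 hδ hs hG
    have h2 : 1 < 2 / μ.real (cyl (x.seg j)) * t := by
      rw [div_mul_eq_mul_div, one_lt_div hpos]
      exact hlt
    nlinarith
  set J := (Finset.range M).filter p with hJ
  have hpos := fun n => hμ.measureReal_cyl_pos hρ hκ n (x.seg n)
  obtain ⟨h1, h2⟩ := inv_le_one_add_sum_inv_sub_inv (m := fun n => μ.real (cyl (x.seg n)))
    hpos (hμ.measureReal_cyl_seg_succ_le x) (hμ.measureReal_cyl_zero _) p M
  rw [← hJ] at h1 h2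
  -- A point outside the ball lies in `[x_j] \ [x_(j+1)]` with `j` its wedge depth. Subadditivity
  -- suffices, so the ball need not be known to be measurable.
  have hcover : 1 ≤ μ.real (intrinsicBall ρ κ δ s μ x t) +
      ∑ j ∈ J, (μ.real (cyl (x.seg j)) - μ.real (cyl (x.seg (j + 1)))) := by
    have hsub : (Set.univ : Set (InfPath A)) ⊆ intrinsicBall ρ κ δ s μ x t ∪
        ⋃ j ∈ J, cyl (x.seg j) \ cyl (x.seg (j + 1)) := by
      intro y _
      by_cases hy : y ∈ intrinsicBall ρ κ δ s μ x t
      · exact Or.inl hy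
      obtain ⟨hxy, hle⟩ := neg_eigenvalue_mul_le_one_of_notMem_intrinsicBall hμ hρ hκ ht hy
      have hpN : p (wedgeDepth x y) := ⟨G_seg_wedgeDepth_pos hμ hρ hκ hxy, hle⟩
      refine Or.inr (Set.mem_biUnion (x := wedgeDepth x y)
        (Finset.mem_filter.2 ⟨Finset.mem_range.2 (hM _ hpN), hpN⟩) ⟨?_, fun hy' => ?_⟩)
      · exact ((seg_eq_iff_le_wedgeDepth hxy _).2 le_rfl).symm
      · have := (seg_eq_iff_le_wedgeDepth hxy _).1 (mem_cyl.1 hy').symm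
        omega
    calc (1 : ℝ) = μ.real Set.univ := probReal_univ.symm
      _ ≤ _ := measureReal_mono hsub
      _ ≤ _ := measureReal_union_le _ _
      _ ≤ _ := by
        gcongr
        refine (measureReal_biUnion_finset_le _ _).trans (Finset.sum_le_sum fun j _ => ?_)
        rw [measureReal_sdiff (cyl_seg_antitone x (Nat.le_succ j)) (measurableSet_cyl _)]
  have hball : (μ.real (intrinsicBall ρ κ δ s μ x t))⁻¹ ≤
      1 + ∑ j ∈ J, evalKernel μ j x x := by
    simp only [evalKernel_self]
    exact (inv_anti₀ ((hpos M).trans_le h1) (by linarith)).trans h2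
  have hlow : 1 + Real.exp (-1) * ∑ j ∈ J, evalKernel μ j x x ≤ heatKernel ρ κ δ s μ ψ t x x := by
    rw [heatKernel_eq hμ hρ hκ hψ, Finset.mul_sum]
    gcongr
    refine le_trans (Finset.sum_le_sum fun j hj => ?_)
      ((summable_exp_mul_evalKernel_self hμ hρ hκ hκ1 hδ hs ht x).sum_le_tsum J fun j _ =>
        mul_nonneg (Real.exp_pos _).le (evalKernel_self_nonneg hμ hρ hκ _ x))
    have := (Finset.mem_filter.1 hj).2.2
    have := evalKernel_self_nonneg hμ hρ hκ j x
    gcongr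
    linarith
  have he : Real.exp (-1) ≤ 1 := Real.exp_le_one_iff.2 (by norm_num)
  rw [one_div, one_div, ← Real.exp_neg]
  calc _ ≤ Real.exp (-1) * (1 + ∑ j ∈ J, evalKernel μ j x x) := by gcongr
    _ ≤ 1 + Real.exp (-1) * ∑ j ∈ J, evalKernel μ j x x := by linarith
    _ ≤ _ := hlow

theorem heatKernel_le (hμ : IsSelfSimilar ρ κ μ) (hρ : ∀ i, 1 < ρ i)
    (hκ : ∀ v, 0 < κ v) (hκ1 : ∀ v, κ v ≤ 1) (hδ : 0 < δ) (hs : s < 2) (hψ : IsEigenbasis μ ψ)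
    {t : ℝ} (ht : 0 < t) {x y : InfPath A} (hxy : x ≠ y) :
    heatKernel ρ κ δ s μ ψ t x y ≤
      1 / (intrinsicDist ρ κ δ s μ x y * μ.real (cyl (wedge x y))) := by
  have hN := hμ.measureReal_cyl_pos hρ hκ _ (x.seg (wedgeDepth x y))
  have ha := two_div_le_neg_eigenvalue hμ hρ hκ hκ1 hδ hs
    (G_seg_wedgeDepth_pos (δ := δ) (s := s) hμ hρ hκ hxy)
  have hle1 := hμ.measureReal_cyl_le_one (x.seg (wedgeDepth x y))
  have h2 : 2 ≤ 2 / μ.real (cyl (x.seg (wedgeDepth x y))) := by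
    rw [le_div_iff₀ hN]
    linarith
  have hrhs : 1 / (intrinsicDist ρ κ δ s μ x y * μ.real (cyl (wedge x y))) =
      -eigenvalue ρ κ δ s μ (x.seg (wedgeDepth x y)) *
        (μ.real (cyl (x.seg (wedgeDepth x y))))⁻¹ := by
    rw [intrinsicDist, if_neg hxy, wedge, one_div, mul_inv, inv_div, div_neg, div_one]
  -- The terms before the wedge telescope to at most `1/μ[x ∧ y] - 1`, and this `-1` cancels the
  -- leading `1` of the heat kernel.
  have hker : heatKernel ρ κ δ s μ ψ t x y ≤ (μ.real (cyl (x.seg (wedgeDepth x y))))⁻¹ := by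
    rw [heatKernel_eq hμ hρ hκ hψ, tsum_eq_sum (s := Finset.range (wedgeDepth x y + 1))
      fun m hm => by rw [evalKernel_of_wedgeDepth_lt hxy (by simpa using hm), mul_zero],
      Finset.sum_range_succ, evalKernel_wedgeDepth hxy]
    have hsum : ∑ m ∈ Finset.range (wedgeDepth x y),
        Real.exp (eigenvalue ρ κ δ s μ (x.seg m) * t) * evalKernel μ m x y ≤
          (μ.real (cyl (x.seg (wedgeDepth x y))))⁻¹ - (μ.real (cyl (x.seg 0)))⁻¹ := by
      rw [← Finset.sum_range_sub fun m => (μ.real (cyl (x.seg m)))⁻¹]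
      refine Finset.sum_le_sum fun m hm => ?_
      rw [evalKernel_of_lt_wedgeDepth hxy (Finset.mem_range.1 hm), ← evalKernel_self]
      refine mul_le_of_le_one_left (evalKernel_self_nonneg hμ hρ hκ m x)
        (Real.exp_le_one_iff.2 ?_)
      exact mul_nonpos_of_nonpos_of_nonneg (eigenvalue_seg_nonpos hμ hρ hκ x m) ht.le
    rw [hμ.measureReal_cyl_zero, inv_one] at hsum
    have : 0 < Real.exp (eigenvalue ρ κ δ s μ (x.seg (wedgeDepth x y)) * t) *
        (μ.real (cyl (x.seg (wedgeDepth x y))))⁻¹ :=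
      mul_pos (Real.exp_pos _) (inv_pos.2 hN)
    linarith
  rw [hrhs]
  -- The extra factor `1/d = -λ` is at least `2`.
  exact hker.trans (le_mul_of_one_le_left (inv_pos.2 hN).le (by linarith))

end HeatKernel

end Finite

end Estimates

end Bratteli

theorem mainTheorem9 {k : ℕ} [NeZero k] {V : Type u} [CategoryTheory.Category.{v} V]
    [Fintype V] [DecidableEq V] (L : KGraph k V) (hfin : L.IsFinite)
    (hconn : L.StronglyConnected) (hρ : ∀ i, 1 < L.rho i)
    (κ : V → ℝ) (hκ : L.IsPerronFrobenius κ)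
    (μ : MeasureTheory.Measure (Bratteli.InfPath L.vertexMatrix))
    (hμ : Bratteli.IsSelfSimilar L.rho κ μ)
    (δ : ℝ) (hδ0 : 0 < δ) (hδ1 : δ < 1)
    (hdiam : Bratteli.DiamEqWeight L.vertexMatrix L.rho κ δ)
    (s : ℝ) (hs : s < 2)
    (ψ : ∀ γ : Bratteli.Node L.vertexMatrix,
      Fin (Bratteli.eigenDim γ) → Bratteli.InfPath L.vertexMatrix → ℝ)
    (hψ : Bratteli.IsEigenbasis μ ψ) :
    (∀ (t : ℝ) (x y : Bratteli.InfPath L.vertexMatrix), 0 < t →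
      Summable (Bratteli.heatTerm L.rho κ δ s μ ψ t x y)) ∧
    (∀ (t : ℝ) (x : Bratteli.InfPath L.vertexMatrix), 0 < t →
      1 / Real.exp 1 * (1 / μ.real (Bratteli.intrinsicBall L.rho κ δ s μ x t)) ≤
        Bratteli.heatKernel L.rho κ δ s μ ψ t x x) ∧
    (∀ (t : ℝ) (x y : Bratteli.InfPath L.vertexMatrix), 0 < t →
      t ≤ Bratteli.intrinsicDist L.rho κ δ s μ x y →
      Bratteli.heatKernel L.rho κ δ s μ ψ t x y ≤
        1 / (Bratteli.intrinsicDist L.rho κ δ s μ x y *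
          μ.real (Bratteli.cyl (Bratteli.wedge x y)))) := by
  have hκ1 : ∀ v, κ v ≤ 1 := fun v => by
    rw [← hκ.2.1]
    exact Finset.single_le_sum (fun w _ => (hκ.1 w).le) (Finset.mem_univ v)
  refine ⟨fun t x y ht => Bratteli.summable_heatTerm hμ hρ hκ.1 hκ1 hδ0 hs hψ ht x y,
    fun t x ht => Bratteli.le_heatKernel_self hμ hρ hκ.1 hκ1 hδ0 hs hψ ht x,
    fun t x y ht htd => Bratteli.heatKernel_le hμ hρ hκ.1 hκ1 hδ0 hs hψ ht ?_⟩
  -- For `x = y` the distance is `0`, against `0 < t ≤ d`.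
  rintro rfl
  rw [Bratteli.intrinsicDist, if_pos rfl] at htd
  exact absurd ht htd.not_gt
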